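/- Proposition (Periodic Clustering). Let $A\ge 0$, $\Pi_0\ge 0$, $\sigma^2>0$. Let $s(x)$, $x\ge 0$, be the stationary solution of $ds/dx=-A\,s+B\,u$ ($u$ white Gaussian noise, $s(0)\sim\mathcal N(0,\Pi_0)$), i.e. the centered Gaussian field with $\mathbb E[s(x)s(x')]=\Pi_0e^{-A|x-x'|}$. Sensors at locations $x_1,\dots,x_n$ (not necessarily distinct) observe $y_i=w_i$ under $H_0$ and $y_i=s(x_i)+w_i$ under $H_1$, where the $w_i\sim\mathcal N(0,\sigma^2)$ are i.i.d. and independent of $s$; put $\mathrm{SNR}=\Pi_0/\sigma^2$. For $\alpha\in(0,1)$ let $P_M(x_1,\dots,x_n;\alpha)$ be the miss probability of the Neyman–Pearson detector of level $\alpha$, i.e. the least probability, under $H_1$, of deciding $H_0$ among all tests that decide $H_1$ with probability at most $\alpha$ under $H_0$. For every $A\ge0$ there is a function $K(\cdot\,;\cdot)$ such that the following hold for all $\Delta>0$, $\Pi_0\ge0$, $\sigma^2>0$ and $\alpha\in(0,1)$. (Uniform configuration.) For $n$ sensors at $0,\Delta,\dots,(n-1)\Delta$ the error exponent exists, does not depend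 on $\alpha$, and depends on $(\Pi_0,\sigma^2)$ through $\mathrm{SNR}$ only: $$\lim_{n\to\infty}-\frac1n\log P_M\bigl(0,\Delta,\dots,(n-1)\Delta;\alpha\bigr)=K(\Delta;\mathrm{SNR}).$$ (Periodic clustering.) Let $M\ge1$ and $\tilde\Delta=M\Delta$. For $n=MN$ sensors placed in $N$ clusters of $M$ co-located sensors each, the clusters being at $0,\tilde\Delta,\dots,(N-1)\tilde\Delta$, the error exponent exists and is $$\tilde K=\lim_{N\to\infty}-\frac1{MN}\log P_M=\frac1M\,K(\tilde\Delta;\,M\cdot\mathrm{SNR}).$$ -/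

import Mathlib

open MeasureTheory ProbabilityTheory
open scoped NNReal

namespace SensorField

/-- Covariance matrix of the samples `s (x i)`, `i : ι`, of the stationary solution of
`ds/dx = - A s + B u` with `s (0) ∼ N(0, Pi0)`, that is, of the centered stationary Gaussian field
with `E[s (x) s (x')] = Pi0 * exp (-A |x - x'|)`. -/
noncomputable def signalCov {ι : Type*} (A : ℝ) (Pi0 : ℝ≥0) (x : ι → ℝ) : Matrix ι ι ℝ :=
  Matrix.of fun i j => (Pi0 : ℝ) * Real.exp (-A * |x i - x j|)

/-- The matrix `signalCov A Pi0 x` is a covariance matrix for all locations, repeated ones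
included; so `multivariateGaussian` is used below on its proper domain only. -/
theorem posSemidef_signalCov {ι : Type*} [Fintype ι] [DecidableEq ι] {A : ℝ} (hA : 0 ≤ A)
    (Pi0 : ℝ≥0) (x : ι → ℝ) : (signalCov A Pi0 x).PosSemidef := by
  have h := posSemidef_matrix_measure_inter (μ := (volume : Measure ℝ))
    (s := fun i : ι => Set.Icc 0 (Real.exp (2 * A * x i)))
    (fun _ => measurableSet_Icc) (fun _ => isCompact_Icc.measure_ne_top)
  have h2 := h.conjTranspose_mul_mul_same
    (Matrix.diagonal fun i => Real.sqrt Pi0 * Real.exp (-A * x i))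
  convert h2 using 1
  ext i j
  have hs : Real.sqrt (Pi0 : ℝ) * Real.sqrt (Pi0 : ℝ) = Pi0 :=
    Real.mul_self_sqrt Pi0.coe_nonneg
  have key : Real.exp (-A * |x i - x j|)
      = Real.exp (-A * x i) * min (Real.exp (2 * A * x i)) (Real.exp (2 * A * x j))
        * Real.exp (-A * x j) := by
    rcases le_total (x i) (x j) with hij | hij
    · rw [min_eq_left (Real.exp_le_exp.2 (by gcongr)), ← Real.exp_add, ← Real.exp_add,
        abs_of_nonpos (by linarith)]
      congr 1; ring
    · rw [min_eq_right (Real.exp_le_exp.2 (by gcongr)), ← Real.exp_add, ← Real.exp_add,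
        abs_of_nonneg (by linarith)]
      congr 1; ring
  have hpos : 0 ≤ min (Real.exp (2 * A * x i)) (Real.exp (2 * A * x j)) :=
    le_min (Real.exp_pos _).le (Real.exp_pos _).le
  simp only [signalCov, Matrix.of_apply, Matrix.diagonal_conjTranspose, Matrix.diagonal_mul,
    Matrix.mul_diagonal, Set.Icc_inter_Icc, max_self, Real.volume_real_Icc,
    star_trivial, sub_zero, key]
  rw [max_eq_left hpos]
  linear_combination (-(Real.exp (-A * x i) *
    min (Real.exp (2 * A * x i)) (Real.exp (2 * A * x j)) * Real.exp (-A * x j))) * hs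

/-- Joint law of the signal samples `s (x i)`, `i : ι`. -/
noncomputable def signalLaw {ι : Type*} [Fintype ι] [DecidableEq ι] (A : ℝ) (Pi0 : ℝ≥0)
    (x : ι → ℝ) : Measure (ι → ℝ) :=
  (multivariateGaussian (0 : EuclideanSpace ℝ ι) (signalCov A Pi0 x)).map WithLp.ofLp

/-- Law of the observations under `H₀ : y i = w i`, with independent `w i ∼ N(0, σ2)`. -/
noncomputable def lawH0 (ι : Type*) [Fintype ι] (σ2 : ℝ≥0) : Measure (ι → ℝ) :=
  Measure.pi fun _ => gaussianReal 0 σ2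

/-- Law of the observations under `H₁ : y i = s (x i) + w i`, with signal and noise
independent. -/
noncomputable def lawH1 {ι : Type*} [Fintype ι] [DecidableEq ι] (A : ℝ) (Pi0 σ2 : ℝ≥0)
    (x : ι → ℝ) : Measure (ι → ℝ) :=
  ((signalLaw A Pi0 x).prod (lawH0 ι σ2)).map fun p => p.1 + p.2

/-- A (randomized) test: `φ y` is the probability of deciding `H₁` on observing `y`. -/
def IsTest {X : Type*} [MeasurableSpace X] (φ : X → ℝ) : Prop :=
  Measurable φ ∧ ∀ y, φ y ∈ Set.Icc (0 : ℝ) 1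

/-- Miss probability of the Neyman-Pearson detector of level `α` for `P0` against `P1`: the least
miss probability among all tests whose false-alarm probability is at most `α`. -/
noncomputable def npMissProb {X : Type*} [MeasurableSpace X] (P0 P1 : Measure X) (α : ℝ) : ℝ :=
  sInf {β | ∃ φ : X → ℝ, IsTest φ ∧ ∫ y, φ y ∂P0 ≤ α ∧ β = ∫ y, (1 - φ y) ∂P1}

/-- Miss probability of the Neyman-Pearson detector of level `α` with sensors at the locations
`x i`, `i : ι`. -/
noncomputable def missProb {ι : Type*} [Fintype ι] [DecidableEq ι] (A : ℝ) (Pi0 σ2 : ℝ≥0)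
    (x : ι → ℝ) (α : ℝ) : ℝ :=
  npMissProb (lawH0 ι σ2) (lawH1 A Pi0 σ2 x) α

/-- Uniform configuration: `n` sensors at `0, Δ, …, (n - 1) Δ`. -/
def uniformLoc (Δ : ℝ) (n : ℕ) : Fin n → ℝ := fun i => (i : ℝ) * Δ

/-- Periodic clustering: `N` clusters, at `0, Δ', …, (N - 1) Δ'`, of `M` co-located sensors
each. -/
def clusterLoc (Δ' : ℝ) (N M : ℕ) : Fin N × Fin M → ℝ := fun k => (k.1 : ℝ) * Δ'

/-- `K` is the error exponent (per sensor) of the miss probability at level `α` for uniform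
configuration with spacing `Δ`. -/
def IsUniformExponent (A : ℝ) (Pi0 σ2 : ℝ≥0) (Δ α K : ℝ) : Prop :=
  Filter.Tendsto
    (fun n : ℕ => -(1 / (n : ℝ)) * Real.log (missProb A Pi0 σ2 (uniformLoc Δ n) α))
    Filter.atTop (nhds K)

/-- `K` is the error exponent (per sensor, with `M * N` sensors) of the miss probability at level
`α` for clusters of `M` co-located sensors with inter-cluster spacing `Δ'`. -/
def IsClusterExponent (A : ℝ) (Pi0 σ2 : ℝ≥0) (M : ℕ) (Δ' α K : ℝ) : Prop :=
  Filter.Tendsto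
    (fun N : ℕ => -(1 / ((M : ℝ) * (N : ℝ))) *
      Real.log (missProb A Pi0 σ2 (clusterLoc Δ' N M) α))
    Filter.atTop (nhds K)

end SensorField

/-! By Stein's lemma (`tendsto_neg_log_npMissProb`) the exponent at every level is the limit in
probability, under `H₀`, of the normalized log-likelihood ratio. After whitening the noise and
diagonalizing the signal covariance (`exists_missProb_eq_npMissProb_pi`), this ratio is a sum of
independent terms whose mean is the Kullback-Leibler divergence and whose variances are uniformly
bounded. Chebyshev's inequality then reduces everything to the limit of the normalized divergence
(`tendsto_neg_log_missProb`).

For uniform spacing the covariance is Toeplitz. The divergence is half the difference of a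
log-determinant and a trace, each subadditive in the number of sensors by a block-diagonal
comparison, so Fekete's lemma gives the limit (`exists_tendsto_divergence_div`).

Clustering needs no further limit: the clustered covariance is a product `B * C` for which `C * B`
is the uniform covariance of one sensor per cluster, multiplied by `M`. The divergence is unchanged
when the factors are swapped (`divergence_mul_comm`), so only the normalization by `M * N` instead
of `N` differs. -/

namespace SensorField

/-! ### Log-determinants and traces of positive matrices. -/

section Matrix

open Matrix Filter Topology

variable {m n : Type*} [Fintype m] [DecidableEq m] [Fintype n] [DecidableEq n]

/-- The Kullback-Leibler divergence of the standard Gaussian from the centered Gaussian with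
covariance matrix `1 + X`. -/
noncomputable def divergence (X : Matrix n n ℝ) : ℝ :=
  1 / 2 * (Real.log (1 + X).det - (X * (1 + X)⁻¹).trace)

/-- Sylvester's identity handles the determinant; the push-through identity `key` and cyclicity
handle the trace. The two products may have different sizes, which is what clustering uses. -/
theorem divergence_mul_comm (B : Matrix m n ℝ) (C : Matrix n m ℝ)
    (h : (1 + B * C).det ≠ 0) : divergence (B * C) = divergence (C * B) := by
  have hdet : (1 + B * C).det = (1 + C * B).det := det_one_add_mul_comm B C
  have hu : IsUnit (1 + B * C).det := isUnit_iff_ne_zero.2 h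
  have hu' : IsUnit (1 + C * B).det := hdet ▸ hu
  have key : C * (1 + B * C)⁻¹ = (1 + C * B)⁻¹ * C := by
    calc C * (1 + B * C)⁻¹
        = (1 + C * B)⁻¹ * ((1 + C * B) * C) * (1 + B * C)⁻¹ := by
          rw [nonsing_inv_mul_cancel_left _ _ hu']
      _ = (1 + C * B)⁻¹ * (C * (1 + B * C)) * (1 + B * C)⁻¹ := by
          congr 2; simp [Matrix.add_mul, Matrix.mul_add, Matrix.mul_assoc]
      _ = (1 + C * B)⁻¹ * C := by
          rw [← Matrix.mul_assoc, mul_nonsing_inv_cancel_right _ _ hu]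
  rw [divergence, divergence, hdet, Matrix.mul_assoc, key, ← Matrix.mul_assoc, trace_mul_comm,
    ← Matrix.mul_assoc, trace_mul_comm, ← Matrix.mul_assoc]

theorem IsHermitian.eq_conj_diagonal {X : Matrix n n ℝ} (hX : X.IsHermitian) :
    X = (hX.eigenvectorUnitary : Matrix n n ℝ) * diagonal hX.eigenvalues
      * (hX.eigenvectorUnitary : Matrix n n ℝ)ᵀ := by
  conv_lhs => rw [hX.spectral_theorem]
  rfl

theorem eigenvectorUnitary_mul_transpose {X : Matrix n n ℝ} (hX : X.IsHermitian) :
    (hX.eigenvectorUnitary : Matrix n n ℝ) * (hX.eigenvectorUnitary : Matrix n n ℝ)ᵀ = 1 :=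
  Unitary.mul_star_self_of_mem hX.eigenvectorUnitary.2

theorem one_add_eq_conj_diagonal {X : Matrix n n ℝ} (hX : X.IsHermitian) :
    1 + X = (hX.eigenvectorUnitary : Matrix n n ℝ) * diagonal (fun i => 1 + hX.eigenvalues i)
      * (hX.eigenvectorUnitary : Matrix n n ℝ)ᵀ := by
  have h1 := eigenvectorUnitary_mul_transpose hX
  have h2 : diagonal (fun i => 1 + hX.eigenvalues i)
      = (1 : Matrix n n ℝ) + diagonal hX.eigenvalues := by
    rw [← diagonal_one, diagonal_add]
  rw [h2, Matrix.mul_add, Matrix.add_mul, Matrix.mul_one, h1, ← IsHermitian.eq_conj_diagonal hX]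

theorem det_one_add_eq_prod {X : Matrix n n ℝ} (hX : X.IsHermitian) :
    (1 + X).det = ∏ i, (1 + hX.eigenvalues i) := by
  have h1 := congrArg det (eigenvectorUnitary_mul_transpose hX)
  rw [det_mul, det_one] at h1
  rw [one_add_eq_conj_diagonal hX, det_mul, det_mul, det_diagonal]
  linear_combination (∏ i, (1 + hX.eigenvalues i)) * h1

theorem trace_inv_one_add_eq_sum {X : Matrix n n ℝ} (hX : X.PosSemidef) :
    (1 + X)⁻¹.trace = ∑ i, (1 + hX.1.eigenvalues i)⁻¹ := by
  have hpos : ∀ i, 1 + hX.1.eigenvalues i ≠ 0 := fun i => by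
    have := hX.eigenvalues_nonneg i; positivity
  have h1 := eigenvectorUnitary_mul_transpose hX.1
  have h1' := mul_eq_one_comm.1 h1
  have hinv : (1 + X)⁻¹ = (hX.1.eigenvectorUnitary : Matrix n n ℝ)
      * diagonal (fun i => (1 + hX.1.eigenvalues i)⁻¹)
      * (hX.1.eigenvectorUnitary : Matrix n n ℝ)ᵀ := by
    apply inv_eq_right_inv
    set U := (hX.1.eigenvectorUnitary : Matrix n n ℝ)
    conv_lhs => rw [one_add_eq_conj_diagonal hX.1]
    calc U * diagonal (fun i => 1 + hX.1.eigenvalues i) * Uᵀ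
          * (U * diagonal (fun i => (1 + hX.1.eigenvalues i)⁻¹) * Uᵀ)
        = U * (diagonal (fun i => 1 + hX.1.eigenvalues i) * (Uᵀ * U)
          * diagonal (fun i => (1 + hX.1.eigenvalues i)⁻¹)) * Uᵀ := by
          simp only [Matrix.mul_assoc]
      _ = 1 := by
          rw [h1', Matrix.mul_one, diagonal_mul_diagonal]
          simp only [mul_inv_cancel₀ (hpos _), diagonal_one, Matrix.mul_one]
          exact h1
  rw [hinv, trace_mul_comm, ← Matrix.mul_assoc, h1', Matrix.one_mul, trace_diagonal]

theorem posDef_one_add {l : Type*} [DecidableEq l] {X : Matrix l l ℝ} (hX : X.PosSemidef) :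
    (1 + X).PosDef :=
  PosDef.one.add_posSemidef hX

theorem trace_mul_inv_one_add {X : Matrix n n ℝ} (hX : X.PosSemidef) :
    (X * (1 + X)⁻¹).trace = Fintype.card n - (1 + X)⁻¹.trace := by
  have hu : IsUnit (1 + X).det := isUnit_iff_ne_zero.2 (posDef_one_add hX).det_pos.ne'
  have h : X * (1 + X)⁻¹ = 1 - (1 + X)⁻¹ := by
    rw [eq_sub_iff_add_eq, add_comm]
    nth_rw 1 [← Matrix.one_mul (1 + X)⁻¹]
    rw [← Matrix.add_mul, mul_nonsing_inv _ hu]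
  rw [h, trace_sub, trace_one]

theorem divergence_eq_sum {X : Matrix n n ℝ} (hX : X.PosSemidef) :
    divergence X = ∑ i, (1 / 2 * Real.log (1 + hX.1.eigenvalues i)
      - 1 / 2 * (1 - (1 + hX.1.eigenvalues i)⁻¹)) := by
  have hpos : ∀ i, 1 + hX.1.eigenvalues i ≠ 0 := fun i => by
    have := hX.eigenvalues_nonneg i; positivity
  rw [divergence, trace_mul_inv_one_add hX, trace_inv_one_add_eq_sum hX,
    det_one_add_eq_prod hX.1, Real.log_prod (fun i _ => hpos i), Finset.sum_sub_distrib,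
    ← Finset.mul_sum, ← Finset.mul_sum, Finset.sum_sub_distrib]
  simp
  ring

/-- Multiply `t ≤ exp (t - 1)` over the eigenvalues. -/
theorem det_le_exp_trace {G : Matrix n n ℝ} (hG : G.PosSemidef) :
    G.det ≤ Real.exp (G.trace - Fintype.card n) := by
  have h1 : G.det = ∏ i, hG.1.eigenvalues i := by simpa using hG.1.det_eq_prod_eigenvalues
  have h2 : G.trace = ∑ i, hG.1.eigenvalues i := by simpa using hG.1.trace_eq_sum_eigenvalues
  have h3 : G.trace - Fintype.card n = ∑ i, (hG.1.eigenvalues i - 1) := by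
    rw [Finset.sum_sub_distrib, h2]; simp
  rw [h1, h3, Real.exp_sum]
  refine Finset.prod_le_prod (fun i _ => hG.eigenvalues_nonneg i) fun i _ => ?_
  have := Real.add_one_le_exp (hG.1.eigenvalues i - 1)
  linarith

/-- If `E⁻¹ F` has the trace of the identity matrix, then `F` has at most the determinant
of `E`. -/
theorem det_le_det_of_trace_inv_mul {E F : Matrix n n ℝ} (hE : E.PosDef) (hF : F.PosSemidef)
    (h : (E⁻¹ * F).trace = Fintype.card n) : F.det ≤ E.det := by
  obtain ⟨C, hC⟩ : ∃ C : Matrix n n ℝ, E⁻¹ = Cᴴ * C := by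
    open scoped MatrixOrder in
    exact CStarAlgebra.nonneg_iff_eq_star_mul_self.mp hE.inv.posSemidef.nonneg
  -- The congruence by `C` turns `E⁻¹ * F` into a positive semidefinite matrix of the same trace, so
  -- the exponential bound is 1.
  have hG := det_le_exp_trace (hF.mul_mul_conjTranspose_same C)
  have htr : (C * F * Cᴴ).trace = Fintype.card n := by
    rw [trace_mul_comm, ← Matrix.mul_assoc, ← hC, h]
  have hdet : (C * F * Cᴴ).det = F.det * E.det⁻¹ := by
    have h1 := congrArg det hC
    rw [det_nonsing_inv, Ring.inverse_eq_inv', det_mul] at h1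
    rw [det_mul, det_mul, h1]; ring
  rw [htr, sub_self, Real.exp_zero, hdet, mul_inv_le_iff₀ hE.det_pos, one_mul] at hG
  exact hG

/-- The tangent inequality at `E` of the convex function `F ↦ tr F⁻¹`, with vanishing linear term by
`h`. It comes from expanding the nonnegative trace of `(F⁻¹ - E⁻¹) * F * (F⁻¹ - E⁻¹)`. -/
theorem trace_inv_le_trace_inv {E F : Matrix n n ℝ} (hE : E.PosDef) (hF : F.PosDef)
    (h : (E⁻¹ * F * E⁻¹).trace = E⁻¹.trace) : E⁻¹.trace ≤ F⁻¹.trace := by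
  have hu : IsUnit F.det := isUnit_iff_ne_zero.2 hF.det_pos.ne'
  have hpsd := (hF.posSemidef.mul_mul_conjTranspose_same (F⁻¹ - E⁻¹)).trace_nonneg
  have hherm : (F⁻¹ - E⁻¹)ᴴ = F⁻¹ - E⁻¹ := (hF.inv.1.sub hE.inv.1).eq
  have hexp : (F⁻¹ - E⁻¹) * F * (F⁻¹ - E⁻¹) = F⁻¹ - E⁻¹ - E⁻¹ + E⁻¹ * F * E⁻¹ := by
    rw [Matrix.sub_mul, nonsing_inv_mul _ hu, Matrix.sub_mul, Matrix.one_mul, Matrix.mul_sub,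
      Matrix.mul_assoc E⁻¹ F F⁻¹, mul_nonsing_inv _ hu, Matrix.mul_one]
    abel
  rw [hherm, hexp, trace_add, trace_sub, trace_sub, h] at hpsd
  linarith

/-! ### Comparison of a block matrix with its block-diagonal part. -/

section Blocks

variable {P : Matrix m m ℝ} {B : Matrix m n ℝ} {C : Matrix n m ℝ} {D : Matrix n n ℝ}

theorem posDef_fromBlocks_zero (hP : P.PosDef) (hD : D.PosDef) :
    (fromBlocks P 0 0 D).PosDef := by
  have := hP.isUnit.invertible
  have h := (hP.fromBlocks₁₁ (0 : Matrix m n ℝ) D).2 (by simpa using hD.posSemidef)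
  rw [conjTranspose_zero] at h
  rw [h.posDef_iff_det_ne_zero, det_fromBlocks_zero₂₁]
  exact mul_ne_zero hP.det_pos.ne' hD.det_pos.ne'

theorem trace_fromBlocks {k l : Type*} [Fintype k] [Fintype l] (P : Matrix k k ℝ)
    (B : Matrix k l ℝ) (C : Matrix l k ℝ) (D : Matrix l l ℝ) :
    (fromBlocks P B C D).trace = P.trace + D.trace := by
  simp [trace]

theorem inv_fromBlocks_zero (hP : P.PosDef) (hD : D.PosDef) :
    (fromBlocks P 0 0 D)⁻¹ = fromBlocks P⁻¹ 0 0 D⁻¹ := by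
  apply inv_eq_right_inv
  rw [fromBlocks_multiply]
  simp [mul_nonsing_inv _ (isUnit_iff_ne_zero.2 hP.det_pos.ne'),
    mul_nonsing_inv _ (isUnit_iff_ne_zero.2 hD.det_pos.ne')]

/-- **Fischer's inequality**. -/
theorem det_fromBlocks_le (hF : (fromBlocks P B C D).PosSemidef) (hP : P.PosDef) (hD : D.PosDef) :
    (fromBlocks P B C D).det ≤ P.det * D.det := by
  rw [← det_fromBlocks_zero₂₁ P 0 D]
  -- The off-diagonal blocks do not contribute to the trace, so the block-diagonal part can serve as
  -- `E`.
  refine det_le_det_of_trace_inv_mul (posDef_fromBlocks_zero hP hD) hF ?_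
  rw [inv_fromBlocks_zero hP hD, fromBlocks_multiply]
  simp [trace_fromBlocks, nonsing_inv_mul _ (isUnit_iff_ne_zero.2 hP.det_pos.ne'),
    nonsing_inv_mul _ (isUnit_iff_ne_zero.2 hD.det_pos.ne')]

theorem trace_inv_fromBlocks_ge (hF : (fromBlocks P B C D).PosDef) (hP : P.PosDef)
    (hD : D.PosDef) : P⁻¹.trace + D⁻¹.trace ≤ (fromBlocks P B C D)⁻¹.trace := by
  have h := trace_inv_le_trace_inv (posDef_fromBlocks_zero hP hD) hF ?_
  · rwa [inv_fromBlocks_zero hP hD, trace_fromBlocks] at h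
  rw [inv_fromBlocks_zero hP hD, fromBlocks_multiply, fromBlocks_multiply]
  simp [trace_fromBlocks, nonsing_inv_mul _ (isUnit_iff_ne_zero.2 hP.det_pos.ne'),
    nonsing_inv_mul _ (isUnit_iff_ne_zero.2 hD.det_pos.ne')]

end Blocks

/-! ### Fekete's lemma for the divergence of Toeplitz matrices. -/

section Toeplitz

variable {c : ℕ → ℕ → ℝ}

theorem submatrix_one_add_eq_fromBlocks (hc : ∀ k i j, c (k + i) (k + j) = c i j) (k l : ℕ) :
    ∃ B C, (1 + of fun i j : Fin (k + l) => c i j).submatrix finSumFinEquiv finSumFinEquiv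
      = fromBlocks (1 + of fun i j : Fin k => c i j) B C (1 + of fun i j : Fin l => c i j) := by
  refine ⟨_, _, (fromBlocks_toBlocks
    ((1 + of fun i j : Fin (k + l) => c i j).submatrix finSumFinEquiv finSumFinEquiv)).symm.trans
    (congrArg₂ (fun P D => fromBlocks P _ _ D) ?_ ?_)⟩
  · ext i j
    simp [toBlocks₁₁, Matrix.one_apply]
  · ext i j
    simp [toBlocks₂₂, Matrix.one_apply, hc]

/-- Shift invariance makes both diagonal blocks members of the same family. Fekete's lemma is
applied to the log-determinant and to the trace separately, since a difference of subadditive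
sequences need not be subadditive. -/
theorem exists_tendsto_divergence_div (hc : ∀ k i j, c (k + i) (k + j) = c i j)
    (hpsd : ∀ k, (of fun i j : Fin k => c i j).PosSemidef) :
    ∃ K, Tendsto (fun k : ℕ => divergence (of fun i j : Fin k => c i j) / k) atTop (𝓝 K) := by
  have hpd := fun k => posDef_one_add (hpsd k)
  have hsub1 : Subadditive fun k => Real.log (1 + of fun i j : Fin k => c i j).det := by
    intro k l
    obtain ⟨B, C, hBC⟩ := submatrix_one_add_eq_fromBlocks hc k l
    have hF := (hpd (k + l)).submatrix (e := finSumFinEquiv) finSumFinEquiv.injective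
    rw [hBC] at hF
    have h := det_fromBlocks_le hF.posSemidef (hpd k) (hpd l)
    rw [← hBC, det_submatrix_equiv_self] at h
    dsimp only
    rw [← Real.log_mul (hpd k).det_pos.ne' (hpd l).det_pos.ne']
    exact Real.log_le_log (hpd (k + l)).det_pos h
  have hsub2 : Subadditive fun k =>
      ((of fun i j : Fin k => c i j) * (1 + of fun i j : Fin k => c i j)⁻¹).trace := by
    intro k l
    obtain ⟨B, C, hBC⟩ := submatrix_one_add_eq_fromBlocks hc k l
    have hF := (hpd (k + l)).submatrix (e := finSumFinEquiv) finSumFinEquiv.injective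
    rw [hBC] at hF
    have h := trace_inv_fromBlocks_ge hF (hpd k) (hpd l)
    rw [← hBC, inv_submatrix_equiv] at h
    have htr : ((1 + of fun i j : Fin (k + l) => c i j)⁻¹.submatrix finSumFinEquiv
        finSumFinEquiv).trace = (1 + of fun i j : Fin (k + l) => c i j)⁻¹.trace := by
      simp only [trace, diag_apply, submatrix_apply]
      exact Equiv.sum_comp finSumFinEquiv fun i => (1 + of fun i j : Fin (k + l) => c i j)⁻¹ i i
    rw [htr] at h
    dsimp only
    -- The trace equals the size minus `tr (1 + X)⁻¹`, so superadditivity of the latter becomes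
    -- subadditivity.
    rw [trace_mul_inv_one_add (hpsd _), trace_mul_inv_one_add (hpsd _),
      trace_mul_inv_one_add (hpsd _)]
    simp only [Fintype.card_fin]
    push_cast
    linarith
  have hb1 : BddBelow (Set.range fun k : ℕ =>
      Real.log (1 + of fun i j : Fin k => c i j).det / k) := by
    refine ⟨0, ?_⟩
    rintro _ ⟨k, rfl⟩
    refine div_nonneg (Real.log_nonneg ?_) k.cast_nonneg
    rw [det_one_add_eq_prod (hpsd k).1]
    calc (1 : ℝ) = ∏ i : Fin k, (1 : ℝ) := by simp
      _ ≤ _ := Finset.prod_le_prod (fun _ _ => zero_le_one)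
            fun i _ => by linarith [(hpsd k).eigenvalues_nonneg i]
  have hb2 : BddBelow (Set.range fun k : ℕ =>
      ((of fun i j : Fin k => c i j) * (1 + of fun i j : Fin k => c i j)⁻¹).trace / k) := by
    refine ⟨0, ?_⟩
    rintro _ ⟨k, rfl⟩
    refine div_nonneg ?_ k.cast_nonneg
    rw [trace_mul_inv_one_add (hpsd k), trace_inv_one_add_eq_sum (hpsd k), sub_nonneg]
    calc _ ≤ ∑ i : Fin k, (1 : ℝ) := Finset.sum_le_sum fun i _ =>
            inv_le_one_of_one_le₀ (by linarith [(hpsd k).eigenvalues_nonneg i])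
      _ = _ := by simp
  refine ⟨_, (((hsub1.tendsto_lim hb1).sub (hsub2.tendsto_lim hb2)).const_mul (1 / 2)).congr
    fun k => ?_⟩
  simp only [divergence]
  ring

end Toeplitz

end Matrix

/-! ### Neyman-Pearson bounds and Stein's lemma. -/

section Stein

open Filter Topology

theorem npMissProb_map {X Y : Type*} [MeasurableSpace X] [MeasurableSpace Y] (e : X ≃ᵐ Y)
    (P0 P1 : Measure X) (α : ℝ) :
    npMissProb (P0.map e) (P1.map e) α = npMissProb P0 P1 α := by
  unfold npMissProb
  congr 1
  ext β
  constructor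
  · rintro ⟨φ, ⟨hm, hφ⟩, hα, rfl⟩
    rw [integral_map_equiv] at hα
    exact ⟨φ ∘ e, ⟨hm.comp e.measurable, fun y => hφ (e y)⟩, hα, integral_map_equiv _ _⟩
  · rintro ⟨φ, ⟨hm, hφ⟩, hα, rfl⟩
    refine ⟨φ ∘ e.symm, ⟨hm.comp e.symm.measurable, fun y => hφ (e.symm y)⟩, ?_, ?_⟩
    · rw [integral_map_equiv]; simpa using hα
    · rw [integral_map_equiv]; simp

variable {X : Type*} [MeasurableSpace X] {P0 P1 : Measure X} {L φ : X → ℝ}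

theorem IsTest.integrable [IsFiniteMeasure P0] (hφ : IsTest φ) : Integrable φ P0 :=
  Integrable.of_bound hφ.1.aestronglyMeasurable 1
    (.of_forall fun y => by rw [Real.norm_of_nonneg (hφ.2 y).1]; exact (hφ.2 y).2)

theorem IsTest.one_sub (hφ : IsTest φ) : IsTest fun y => 1 - φ y :=
  ⟨measurable_const.sub hφ.1, fun y => ⟨by linarith [(hφ.2 y).2], by linarith [(hφ.2 y).1]⟩⟩

theorem bddBelow_missProb (P0 P1 : Measure X) (α : ℝ) :
    BddBelow {β | ∃ φ : X → ℝ, IsTest φ ∧ ∫ y, φ y ∂P0 ≤ α ∧ β = ∫ y, (1 - φ y) ∂P1} := by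
  refine ⟨0, ?_⟩
  rintro _ ⟨φ, hφ, -, rfl⟩
  exact integral_nonneg fun y => (hφ.one_sub.2 y).1

theorem integral_withDensity_exp_neg (hL : Measurable L)
    (hP1 : P1 = P0.withDensity fun y => ENNReal.ofReal (Real.exp (-L y))) (g : X → ℝ) :
    ∫ y, g y ∂P1 = ∫ y, Real.exp (-L y) * g y ∂P0 := by
  rw [hP1, integral_withDensity_eq_integral_toReal_smul (by fun_prop) (by simp)]
  simp [ENNReal.toReal_ofReal (Real.exp_pos _).le]

theorem integrable_exp_neg_mul [IsFiniteMeasure P1] (hL : Measurable L)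
    (hP1 : P1 = P0.withDensity fun y => ENNReal.ofReal (Real.exp (-L y))) (hφ : IsTest φ) :
    Integrable (fun y => Real.exp (-L y) * φ y) P0 := by
  have h : Integrable φ P1 := hφ.integrable
  rw [hP1, integrable_withDensity_iff_integrable_smul' (by fun_prop) (by simp)] at h
  simpa [ENNReal.toReal_ofReal (Real.exp_pos _).le] using h

/-- The likelihood ratio test deciding `H₁` on `L < c` suffices: where it decides `H₀`, the density
of `P1` is at most `exp (-c)`. -/
theorem npMissProb_le_exp_neg [IsProbabilityMeasure P0] [IsFiniteMeasure P1] (hL : Measurable L)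
    (hP1 : P1 = P0.withDensity fun y => ENNReal.ofReal (Real.exp (-L y))) {c α : ℝ}
    (hα : P0.real {y | L y < c} ≤ α) : npMissProb P0 P1 α ≤ Real.exp (-c) := by
  have hs : MeasurableSet {y | L y < c} := measurableSet_lt hL measurable_const
  have hφ : IsTest ({y | L y < c}.indicator fun _ => (1 : ℝ)) := by
    refine ⟨measurable_const.indicator hs, fun y => ?_⟩
    by_cases hy : L y < c <;> simp [Set.indicator, hy]
  refine (csInf_le (bddBelow_missProb P0 P1 α) ⟨_, hφ, ?_, rfl⟩).trans ?_
  · rw [integral_indicator_const _ hs]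
    simpa using hα
  · rw [integral_withDensity_exp_neg hL hP1]
    calc _ ≤ ∫ _, Real.exp (-c) ∂P0 := by
          refine integral_mono (integrable_exp_neg_mul hL hP1 hφ.one_sub) (integrable_const _)
            fun y => ?_
          by_cases hy : L y < c
          · simp [Set.indicator, hy, (Real.exp_pos _).le]
          · simp [Set.indicator, hy, not_lt.1 hy]
      _ = Real.exp (-c) := by simp

/-- Change of measure: any test decides `H₀` with `P0`-probability at least `1 - α`. Discarding the
event `c < L` leaves a region where the density of `P1` is at least `exp (-c)`. -/
theorem exp_neg_mul_le_npMissProb [IsProbabilityMeasure P0] [IsFiniteMeasure P1]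
    (hL : Measurable L)
    (hP1 : P1 = P0.withDensity fun y => ENNReal.ofReal (Real.exp (-L y))) {c α : ℝ}
    (hα : 0 ≤ α) :
    Real.exp (-c) * (1 - α - P0.real {y | c < L y}) ≤ npMissProb P0 P1 α := by
  have hs : MeasurableSet {y | c < L y} := measurableSet_lt measurable_const hL
  refine le_csInf ⟨_, fun _ => 0, ⟨measurable_const, by simp⟩, by simpa using hα, rfl⟩ ?_
  rintro _ ⟨φ, hφ, hφα, rfl⟩
  have hint : Integrable ({y | c < L y}.indicator fun _ => (1 : ℝ)) P0 :=
    (integrable_const _).indicator hs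
  calc Real.exp (-c) * (1 - α - P0.real {y | c < L y})
      ≤ Real.exp (-c) * (1 - ∫ y, φ y ∂P0 - P0.real {y | c < L y}) := by gcongr
    _ = ∫ y, Real.exp (-c) * ((1 - φ y) - {y | c < L y}.indicator (fun _ => (1 : ℝ)) y) ∂P0 := by
        rw [integral_const_mul, integral_sub hφ.one_sub.integrable hint,
          integral_sub (integrable_const _) hφ.integrable, integral_indicator_const _ hs]
        simp
    _ ≤ ∫ y, Real.exp (-L y) * (1 - φ y) ∂P0 := by
        refine integral_mono ((hφ.one_sub.integrable.sub hint).const_mul _)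
          (integrable_exp_neg_mul hL hP1 hφ.one_sub) fun y => ?_
        have h0 := (hφ.2 y).1
        have h1 := (hφ.one_sub.2 y).1
        by_cases hy : c < L y
        · simp only [Set.indicator, Set.mem_ofPred_eq, hy, if_true]
          exact (mul_nonpos_of_nonneg_of_nonpos (Real.exp_pos _).le (by linarith)).trans
            (mul_nonneg (Real.exp_pos _).le h1)
        · simp only [Set.indicator, Set.mem_ofPred_eq, hy, if_false, sub_zero]
          gcongr
          exact not_lt.1 hy
    _ = _ := (integral_withDensity_exp_neg hL hP1 _).symm

/-- **Stein's lemma**: if the normalized log-likelihood ratio converges in probability under the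
null hypothesis, its limit is the error exponent at every level. -/
theorem tendsto_neg_log_npMissProb {X : ℕ → Type*} [∀ n, MeasurableSpace (X n)]
    {P0 P1 : ∀ n, Measure (X n)} [∀ n, IsProbabilityMeasure (P0 n)] [∀ n, IsFiniteMeasure (P1 n)]
    {L : ∀ n, X n → ℝ} (hL : ∀ n, Measurable (L n))
    (hP1 : ∀ n, P1 n = (P0 n).withDensity fun y => ENNReal.ofReal (Real.exp (-L n y)))
    {a : ℕ → ℝ} (ha : Tendsto a atTop atTop) {K : ℝ}
    (hconv : ∀ ε > 0,
      Tendsto (fun n => (P0 n).real {y | ε * a n ≤ |L n y - K * a n|}) atTop (𝓝 0))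
    {α : ℝ} (hα : α ∈ Set.Ioo (0 : ℝ) 1) :
    Tendsto (fun n => -(1 / a n) * Real.log (npMissProb (P0 n) (P1 n) α)) atTop (𝓝 K) := by
  rw [Metric.tendsto_nhds]
  intro ε hε
  have hε3 : 0 < ε / 3 := by positivity
  -- In the converse bound half of `1 - α` absorbs the deviation probability. The logarithm of the
  -- other half is negligible against `a n` and costs a second `ε / 3`.
  have hα1 : 0 < (1 - α) / 2 := by linarith [hα.2]
  have hlog : Tendsto (fun n => Real.log ((1 - α) / 2) / a n) atTop (𝓝 0) :=
    tendsto_const_nhds.div_atTop ha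
  filter_upwards [ha.eventually_gt_atTop 0, (hconv _ hε3).eventually_lt_const hα.1,
    (hconv _ hε3).eventually_lt_const hα1, hlog.eventually_const_lt (neg_neg_of_pos hε3)]
    with n hn h1 h2 h3
  have hup : npMissProb (P0 n) (P1 n) α ≤ Real.exp (-((K - ε / 3) * a n)) := by
    refine npMissProb_le_exp_neg (hL n) (hP1 n) ((measureReal_mono fun y hy => ?_).trans h1.le)
    simp only [Set.mem_ofPred_eq] at hy ⊢
    exact le_abs.2 (Or.inr (by linarith))
  have hlow : Real.exp (-((K + ε / 3) * a n)) * ((1 - α) / 2) ≤ npMissProb (P0 n) (P1 n) α := by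
    refine le_trans ?_ (exp_neg_mul_le_npMissProb (hL n) (hP1 n) (c := (K + ε / 3) * a n) hα.1.le)
    have hmono : (P0 n).real {y | (K + ε / 3) * a n < L n y}
        ≤ (P0 n).real {y | ε / 3 * a n ≤ |L n y - K * a n|} := by
      refine measureReal_mono fun y hy => ?_
      simp only [Set.mem_ofPred_eq] at hy ⊢
      exact le_abs.2 (Or.inl (by linarith))
    gcongr
    linarith
  have hpos : 0 < npMissProb (P0 n) (P1 n) α := lt_of_lt_of_le (by positivity) hlow
  have hup' := Real.log_le_log hpos hup
  have hlow' := Real.log_le_log (by positivity) hlow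
  rw [Real.log_exp] at hup'
  rw [Real.log_mul (Real.exp_pos _).ne' hα1.ne', Real.log_exp] at hlow'
  have h3' : -(ε / 3) * a n < Real.log ((1 - α) / 2) := (lt_div_iff₀ hn).1 h3
  have heq : -(1 / a n) * Real.log (npMissProb (P0 n) (P1 n) α)
      = -Real.log (npMissProb (P0 n) (P1 n) α) / a n := by ring
  rw [heq, Real.dist_eq, abs_lt]
  constructor
  · rw [neg_lt_sub_iff_lt_add, ← sub_lt_iff_lt_add', lt_div_iff₀ hn]
    nlinarith
  · rw [sub_lt_iff_lt_add, div_lt_iff₀ hn]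
    nlinarith

end Stein

/-! ### Gaussian likelihood ratios and diagonalization of the detection problem. -/

section GaussianLaws

open Filter Topology Matrix

variable {ι : Type*} [Fintype ι]

theorem pi_withDensity {μ : ι → Measure ℝ} [∀ i, IsProbabilityMeasure (μ i)]
    {f : ι → ℝ → ENNReal} (hf : ∀ i, Measurable (f i))
    [∀ i, SigmaFinite ((μ i).withDensity (f i))] :
    Measure.pi (fun i => (μ i).withDensity (f i))
      = (Measure.pi μ).withDensity fun y => ∏ i, f i (y i) := by
  refine Measure.pi_eq fun s hs => ?_
  have hind : ∀ y : ι → ℝ, (Set.univ.pi s).indicator (fun y => ∏ i, f i (y i)) y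
      = ∏ i, (s i).indicator (f i) (y i) := by
    intro y
    by_cases hy : y ∈ Set.univ.pi s
    · rw [Set.indicator_of_mem hy]
      exact Finset.prod_congr rfl fun i _ =>
        (Set.indicator_of_mem (hy i (Set.mem_univ i)) _).symm
    · rw [Set.indicator_of_notMem hy]
      obtain ⟨i, hi⟩ : ∃ i, y i ∉ s i := by simpa [Set.mem_univ_pi] using hy
      exact (Finset.prod_eq_zero (Finset.mem_univ i) (Set.indicator_of_notMem hi _)).symm
  have hm : ∀ i, Measurable ((s i).indicator (f i)) := fun i => (hf i).indicator (hs i)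
  rw [withDensity_apply _ (.univ_pi hs), ← lintegral_indicator (.univ_pi hs)]
  simp_rw [hind]
  have hprod := lintegral_prod_eq_prod_lintegral_of_indepFun (μ := Measure.pi μ) Finset.univ
    (fun i (y : ι → ℝ) => (s i).indicator (f i) (y i))
    (iIndepFun_pi fun i => (hm i).aemeasurable) (fun i => (hm i).comp (measurable_pi_apply i))
  rw [hprod]
  refine Finset.prod_congr rfl fun i _ => ?_
  rw [(measurePreserving_eval μ i).lintegral_comp (hm i), lintegral_indicator (hs i),
    withDensity_apply _ (hs i)]

/-- Logarithm of the density of `N(0, 1)` with respect to `N(0, v)`. -/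
noncomputable def gaussianLLR (v : ℝ≥0) (z : ℝ) : ℝ :=
  1 / 2 * Real.log v - 1 / 2 * (1 - (v : ℝ)⁻¹) * z ^ 2

theorem measurable_gaussianLLR (v : ℝ≥0) : Measurable (gaussianLLR v) := by
  unfold gaussianLLR; fun_prop

theorem gaussianReal_eq_withDensity {v : ℝ≥0} (hv : v ≠ 0) :
    gaussianReal 0 v = (gaussianReal 0 1).withDensity
      fun z => ENNReal.ofReal (Real.exp (-gaussianLLR v z)) := by
  have hv' : (0 : ℝ) < v := by positivity
  rw [gaussianReal_of_var_ne_zero _ hv, gaussianReal_of_var_ne_zero _ one_ne_zero,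
    ← withDensity_mul _ (measurable_gaussianPDF 0 1)
      (by have := measurable_gaussianLLR v; fun_prop)]
  congr 1
  ext1 z
  rw [Pi.mul_apply, gaussianPDF, gaussianPDF, ← ENNReal.ofReal_mul (gaussianPDFReal_nonneg _ _ _)]
  congr 1
  have h1 : Real.exp (-gaussianLLR v z)
      = (√(v : ℝ))⁻¹ * Real.exp (1 / 2 * (1 - (v : ℝ)⁻¹) * z ^ 2) := by
    rw [gaussianLLR, neg_sub, sub_eq_neg_add, Real.exp_add, Real.exp_neg, Real.sqrt_eq_rpow,
      Real.rpow_def_of_pos hv', mul_comm (Real.log _)]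
  rw [gaussianPDFReal, gaussianPDFReal, h1, Real.sqrt_mul (by positivity), NNReal.coe_one, mul_one,
    mul_inv]
  have h2 : Real.exp (-(z - 0) ^ 2 / (2 * v))
      = Real.exp (-(z - 0) ^ 2 / (2 * 1)) * Real.exp (1 / 2 * (1 - (v : ℝ)⁻¹) * z ^ 2) := by
    rw [← Real.exp_add]
    congr 1
    field_simp
    ring
  rw [h2]
  ring

theorem pi_gaussianReal_eq_withDensity {v : ι → ℝ≥0} (hv : ∀ i, v i ≠ 0) :
    Measure.pi (fun i => gaussianReal 0 (v i))
      = (Measure.pi fun _ : ι => gaussianReal 0 1).withDensity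
      fun z => ENNReal.ofReal (Real.exp (-∑ i, gaussianLLR (v i) (z i))) := by
  have hm := fun i => measurable_gaussianLLR (v i)
  have := fun i => gaussianReal_eq_withDensity (hv i) ▸
    (inferInstance : SigmaFinite (gaussianReal 0 (v i)))
  simp_rw [fun i => gaussianReal_eq_withDensity (hv i)]
  rw [pi_withDensity fun i => by fun_prop]
  congr 1
  ext1 z
  rw [← ENNReal.ofReal_prod_of_nonneg fun i _ => (Real.exp_pos _).le, ← Real.exp_sum,
    Finset.sum_neg_distrib]

theorem memLp_sq_gaussianReal : MemLp (fun z : ℝ => z ^ 2) 2 (gaussianReal 0 1) := by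
  rw [memLp_two_iff_integrable_sq (by fun_prop)]
  have h := (memLp_id_gaussianReal (μ := 0) (v := 1) 4).integrable_norm_pow (by norm_num)
  refine h.congr (.of_forall fun z => ?_)
  simp only [id, Real.norm_eq_abs, Even.pow_abs ⟨2, rfl⟩]
  ring

theorem integral_sq_gaussianReal : ∫ z : ℝ, z ^ 2 ∂gaussianReal 0 1 = 1 := by
  have h := variance_fun_id_gaussianReal (μ := 0) (v := 1)
  rw [variance_of_integral_eq_zero (by fun_prop) (by simp)] at h
  simpa using h

theorem memLp_gaussianLLR (v : ℝ≥0) : MemLp (gaussianLLR v) 2 (gaussianReal 0 1) :=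
  (memLp_const _).sub (memLp_sq_gaussianReal.const_mul _)

theorem integral_gaussianLLR (v : ℝ≥0) :
    ∫ z, gaussianLLR v z ∂gaussianReal 0 1 = 1 / 2 * Real.log v - 1 / 2 * (1 - (v : ℝ)⁻¹) := by
  simp only [gaussianLLR]
  rw [integral_sub (integrable_const _)
    ((memLp_sq_gaussianReal.integrable (by norm_num)).const_mul _),
    integral_const_mul _ fun z : ℝ => z ^ 2, integral_sq_gaussianReal]
  simp

/-- The coefficient of `z ^ 2` stays in `[-1/2, 0]` for all `v ≥ 1`. Hence no bound on the
eigenvalues is needed; for `A = 0` the largest one can grow linearly with the number of sensors. -/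
theorem variance_gaussianLLR_le {v : ℝ≥0} (hv : 1 ≤ v) :
    Var[gaussianLLR v; gaussianReal 0 1] ≤ Var[fun z : ℝ => z ^ 2; gaussianReal 0 1] := by
  have hv' : (1 : ℝ) ≤ v := by exact_mod_cast hv
  have h0 : 0 ≤ 1 - (v : ℝ)⁻¹ := sub_nonneg.2 (inv_le_one_of_one_le₀ hv')
  have h1 : 1 - (v : ℝ)⁻¹ ≤ 1 := by simp
  unfold gaussianLLR
  rw [variance_const_sub (by fun_prop), variance_const_mul]
  refine mul_le_of_le_one_left (variance_nonneg _ _) ?_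
  nlinarith

/-- Chebyshev's inequality for the log-likelihood ratio of centered Gaussian vectors with
independent components. -/
theorem measureReal_deviation_sum_gaussianLLR_le {v : ι → ℝ≥0} (hv : ∀ i, 1 ≤ v i) {c : ℝ}
    (hc : 0 < c) :
    (Measure.pi fun _ : ι => gaussianReal 0 1).real {z | c ≤ |∑ i, gaussianLLR (v i) (z i)
        - ∑ i, (1 / 2 * Real.log (v i) - 1 / 2 * (1 - (v i : ℝ)⁻¹))|}
      ≤ Var[fun z : ℝ => z ^ 2; gaussianReal 0 1] * Fintype.card ι / c ^ 2 := by
  have hmem : ∀ i, MemLp (fun z : ι → ℝ => gaussianLLR (v i) (z i)) 2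
      (Measure.pi fun _ : ι => gaussianReal 0 1) := fun i =>
    (memLp_gaussianLLR (v i)).comp_measurePreserving (measurePreserving_eval _ i)
  have hmean : ∫ z, ∑ i, gaussianLLR (v i) (z i) ∂(Measure.pi fun _ : ι => gaussianReal 0 1)
      = ∑ i, (1 / 2 * Real.log (v i) - 1 / 2 * (1 - (v i : ℝ)⁻¹)) := by
    rw [integral_finsetSum _ fun i _ => (hmem i).integrable (by norm_num)]
    refine Finset.sum_congr rfl fun i _ => ?_
    rw [← integral_gaussianLLR]
    exact integral_comp_eval (μ := fun _ : ι => gaussianReal 0 1)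
      (measurable_gaussianLLR (v i)).aestronglyMeasurable
  have hvar : Var[fun z => ∑ i, gaussianLLR (v i) (z i); Measure.pi fun _ : ι => gaussianReal 0 1]
      ≤ Var[fun z : ℝ => z ^ 2; gaussianReal 0 1] * Fintype.card ι := by
    have h := variance_sum_pi (μ := fun _ : ι => gaussianReal 0 1)
      fun i => memLp_gaussianLLR (v i)
    rw [Finset.sum_fn] at h
    rw [h]
    calc _ ≤ ∑ _ : ι, Var[fun z : ℝ => z ^ 2; gaussianReal 0 1] :=
          Finset.sum_le_sum fun i _ => variance_gaussianLLR_le (hv i)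
      _ = _ := by simp [mul_comm]
  have h := meas_ge_le_variance_div_sq (memLp_finsetSum Finset.univ fun i _ => hmem i) hc
  rw [hmean] at h
  refine (ENNReal.toReal_mono ENNReal.ofReal_ne_top h).trans ?_
  rw [ENNReal.toReal_ofReal (div_nonneg (variance_nonneg _ _) (sq_nonneg _))]
  gcongr

/-- Moving `G` to the other side of the inner product leaves the characteristic function of a
product measure. -/
theorem charFun_map_mulVec_pi_gaussianReal (G : Matrix ι ι ℝ) [DecidableEq ι] (v : ι → ℝ≥0)
    (t : EuclideanSpace ℝ ι) :
    charFun (((Measure.pi fun i => gaussianReal 0 (v i)).map (G *ᵥ ·)).map (WithLp.toLp 2)) t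
      = Complex.exp (-((t.ofLp ⬝ᵥ (G * diagonal (fun i => (v i : ℝ)) * Gᵀ) *ᵥ t.ofLp : ℝ) : ℂ)
        / 2) := by
  have hG : Measurable fun x : ι → ℝ => G *ᵥ x := by fun_prop
  have hadj : charFun (((Measure.pi fun i => gaussianReal 0 (v i)).map (G *ᵥ ·)).map
      (WithLp.toLp 2)) t = charFun ((Measure.pi fun i => gaussianReal 0 (v i)).map (WithLp.toLp 2))
        (WithLp.toLp 2 (Gᵀ *ᵥ t.ofLp)) := by
    rw [charFun_apply, charFun_apply, integral_map (by fun_prop) (by fun_prop),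
      integral_map (by fun_prop) (by fun_prop), integral_map (by fun_prop) (by fun_prop)]
    congr 1
    ext x
    congr 3
    simp only [EuclideanSpace.inner_eq_star_dotProduct, star_trivial]
    rw [dotProduct_mulVec, mulVec_transpose]
  rw [hadj, charFun_pi]
  simp_rw [charFun_gaussianReal]
  rw [← Complex.exp_sum]
  congr 1
  have hq : t.ofLp ⬝ᵥ (G * diagonal (fun i => (v i : ℝ)) * Gᵀ) *ᵥ t.ofLp
      = ∑ i, (v i : ℝ) * (Gᵀ *ᵥ t.ofLp) i ^ 2 := by
    rw [← mulVec_mulVec, ← mulVec_mulVec, dotProduct_mulVec, ← mulVec_transpose, dotProduct]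
    refine Finset.sum_congr rfl fun i _ => ?_
    rw [mulVec_diagonal]
    ring
  rw [hq]
  push_cast
  rw [neg_div, Finset.sum_div, ← Finset.sum_neg_distrib]
  exact Finset.sum_congr rfl fun i _ => by ring

theorem map_toLp_injective {κ : Type*} {μ ν : Measure (κ → ℝ)}
    (h : μ.map (WithLp.toLp 2) = ν.map (WithLp.toLp 2)) : μ = ν :=
  (MeasurableEquiv.toLp 2 (κ → ℝ)).map_measurableEquiv_injective h

variable [DecidableEq ι]

instance isProbabilityMeasure_lawH0 (σ2 : ℝ≥0) : IsProbabilityMeasure (lawH0 ι σ2) := by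
  unfold lawH0; infer_instance

instance isProbabilityMeasure_lawH1 (A : ℝ) (Pi0 σ2 : ℝ≥0) (x : ι → ℝ) :
    IsProbabilityMeasure (lawH1 A Pi0 σ2 x) := by
  have : IsProbabilityMeasure (signalLaw A Pi0 x) :=
    Measure.isProbabilityMeasure_map (by fun_prop)
  exact Measure.isProbabilityMeasure_map (by fun_prop)

theorem charFun_map_toLp_lawH0 (σ2 : ℝ≥0) (t : EuclideanSpace ℝ ι) :
    charFun ((lawH0 ι σ2).map (WithLp.toLp 2)) t
      = Complex.exp (-((t.ofLp ⬝ᵥ ((σ2 : ℝ) • (1 : Matrix ι ι ℝ)) *ᵥ t.ofLp : ℝ) : ℂ) / 2) := by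
  have h := charFun_map_mulVec_pi_gaussianReal (1 : Matrix ι ι ℝ) (fun _ => σ2) t
  simp only [one_mulVec, Measure.map_id', Matrix.one_mul, transpose_one, Matrix.mul_one] at h
  rw [lawH0, h, smul_one_eq_diagonal]

theorem charFun_map_toLp_lawH1 {A : ℝ} (hA : 0 ≤ A) (Pi0 σ2 : ℝ≥0) (x : ι → ℝ)
    (t : EuclideanSpace ℝ ι) :
    charFun ((lawH1 A Pi0 σ2 x).map (WithLp.toLp 2)) t
      = Complex.exp (-((t.ofLp ⬝ᵥ
          (signalCov A Pi0 x + (σ2 : ℝ) • (1 : Matrix ι ι ℝ)) *ᵥ t.ofLp : ℝ) : ℂ) / 2) := by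
  have hmap : (lawH1 A Pi0 σ2 x).map (WithLp.toLp 2)
      = ((multivariateGaussian 0 (signalCov A Pi0 x)).prod
        ((lawH0 ι σ2).map (WithLp.toLp 2))).map fun p => p.1 + p.2 := by
    have hid : multivariateGaussian 0 (signalCov A Pi0 x)
        = (signalLaw A Pi0 x).map (WithLp.toLp 2) := by
      rw [signalLaw, Measure.map_map (by fun_prop) (by fun_prop)]
      exact Measure.map_id.symm
    have : IsProbabilityMeasure (signalLaw A Pi0 x) :=
      Measure.isProbabilityMeasure_map (by fun_prop)
    rw [hid, Measure.map_prod_map _ _ (by fun_prop) (by fun_prop), lawH1,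
      Measure.map_map (by fun_prop) (by fun_prop), Measure.map_map (by fun_prop) (by fun_prop)]
    rfl
  have : IsProbabilityMeasure ((lawH0 ι σ2).map (WithLp.toLp 2)) :=
    Measure.isProbabilityMeasure_map (by fun_prop)
  rw [hmap, charFun_map_add_prod_eq_mul, Pi.mul_apply, charFun_map_toLp_lawH0,
    charFun_multivariateGaussian (posSemidef_signalCov hA Pi0 x), ← Complex.exp_add, add_mulVec,
    dotProduct_add]
  congr 1
  simp
  ring

/-- An invertible matrix as a measurable equivalence. -/
noncomputable def mulVecEquiv (G : Matrix ι ι ℝ) (hG : IsUnit G.det) :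
    (ι → ℝ) ≃ᵐ (ι → ℝ) where
  toFun := (G *ᵥ ·)
  invFun := (G⁻¹ *ᵥ ·)
  left_inv x := by simp [mulVec_mulVec, nonsing_inv_mul _ hG]
  right_inv x := by simp [mulVec_mulVec, mul_nonsing_inv _ hG]
  measurable_toFun := by simp only [Equiv.coe_fn_mk]; fun_prop
  measurable_invFun := by simp only [Equiv.coe_fn_symm_mk]; fun_prop

/-- The reason why only the ratio `Pi0 / σ2` matters: the noise level is a common scale of both
hypotheses. -/
theorem signalCov_add_smul_one {κ : Type*} [DecidableEq κ] (A : ℝ) (Pi0 : ℝ≥0) {σ2 : ℝ≥0}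
    (hσ : 0 < σ2) (x : κ → ℝ) :
    signalCov A Pi0 x + (σ2 : ℝ) • (1 : Matrix κ κ ℝ)
      = (σ2 : ℝ) • (1 + signalCov A (Pi0 / σ2) x) := by
  have hσ' : (σ2 : ℝ) ≠ 0 := by positivity
  ext i j
  simp only [signalCov, Matrix.add_apply, Matrix.smul_apply, Matrix.of_apply, smul_eq_mul,
    NNReal.coe_div]
  field_simp
  ring

/-- In the coordinates which diagonalize the signal covariance, the detection problem is the one
for a Gaussian vector with independent components. -/
theorem exists_missProb_eq_npMissProb_pi {A : ℝ} (hA : 0 ≤ A) (Pi0 : ℝ≥0) {σ2 : ℝ≥0}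
    (hσ : 0 < σ2) (x : ι → ℝ) :
    ∃ v : ι → ℝ≥0, (∀ i, 1 ≤ v i) ∧
      divergence (signalCov A (Pi0 / σ2) x)
        = ∑ i, (1 / 2 * Real.log (v i) - 1 / 2 * (1 - (v i : ℝ)⁻¹)) ∧
      ∀ α, missProb A Pi0 σ2 x α = npMissProb (Measure.pi fun _ : ι => gaussianReal 0 1)
        (Measure.pi fun i : ι => gaussianReal 0 (v i)) α := by
  have hX := posSemidef_signalCov hA (Pi0 / σ2) x
  have hσ' : (0 : ℝ) < σ2 := by positivity
  set U := (hX.1.eigenvectorUnitary : Matrix ι ι ℝ) with hU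
  have hUU : U * Uᵀ = 1 := eigenvectorUnitary_mul_transpose hX.1
  have hss : √(σ2 : ℝ) * √(σ2 : ℝ) = σ2 := Real.mul_self_sqrt hσ'.le
  have hconj : ∀ D : Matrix ι ι ℝ, (√(σ2 : ℝ) • U) * D * (√(σ2 : ℝ) • U)ᵀ
      = (σ2 : ℝ) • (U * D * Uᵀ) := fun D => by
    rw [transpose_smul, Matrix.smul_mul, Matrix.smul_mul, Matrix.mul_smul, smul_smul, hss]
  have hG : IsUnit (√(σ2 : ℝ) • U).det := by
    have h := congrArg det (hconj 1)
    rw [Matrix.mul_one, Matrix.mul_one, hUU, det_mul, det_smul (1 : Matrix ι ι ℝ), det_one] at h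
    refine isUnit_of_mul_isUnit_left (y := (√(σ2 : ℝ) • U)ᵀ.det) ?_
    rw [h]
    exact isUnit_iff_ne_zero.2 (by positivity)
  -- The same map `√σ2 • U` carries both product laws to the observation laws: orthogonality
  -- preserves the white noise, while the columns of `U` diagonalize the signal.
  have h0 : lawH0 ι σ2
      = (Measure.pi fun _ : ι => gaussianReal 0 1).map (mulVecEquiv _ hG) := by
    apply map_toLp_injective
    apply Measure.ext_of_charFun
    ext t
    rw [charFun_map_toLp_lawH0]
    refine Eq.trans ?_ (charFun_map_mulVec_pi_gaussianReal _ (fun _ => 1) t).symm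
    rw [hconj]
    simp [hUU]
  have h1 : lawH1 A Pi0 σ2 x
      = (Measure.pi fun i : ι => gaussianReal 0 (1 + hX.1.eigenvalues i).toNNReal).map
        (mulVecEquiv _ hG) := by
    apply map_toLp_injective
    apply Measure.ext_of_charFun
    ext t
    rw [charFun_map_toLp_lawH1 hA]
    refine Eq.trans ?_ (charFun_map_mulVec_pi_gaussianReal _ _ t).symm
    have hdiag : (fun i => ((1 + hX.1.eigenvalues i).toNNReal : ℝ))
        = fun i => 1 + hX.1.eigenvalues i := by
      ext i
      exact Real.coe_toNNReal _ (by linarith [hX.eigenvalues_nonneg i])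
    rw [hconj, hdiag, hU, ← one_add_eq_conj_diagonal hX.1, signalCov_add_smul_one A Pi0 hσ]
  refine ⟨fun i => (1 + hX.1.eigenvalues i).toNNReal, fun i => ?_, ?_, fun α => ?_⟩
  · rw [← Real.toNNReal_one]
    exact Real.toNNReal_le_toNNReal (by linarith [hX.eigenvalues_nonneg i])
  · rw [divergence_eq_sum hX]
    refine Finset.sum_congr rfl fun i _ => ?_
    rw [Real.coe_toNNReal _ (by linarith [hX.eigenvalues_nonneg i])]
  · rw [missProb, h0, h1, npMissProb_map]

end GaussianLaws

/-! ### Error exponents of sensor configurations. -/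

section Exponent

open Filter Topology

/-- If the divergence between the two hypotheses, normalized by `a n`, converges, then its limit
is the error exponent. -/
theorem tendsto_neg_log_missProb {ι : ℕ → Type*} [∀ n, Fintype (ι n)] [∀ n, DecidableEq (ι n)]
    {A : ℝ} (hA : 0 ≤ A) (Pi0 : ℝ≥0) {σ2 : ℝ≥0} (hσ : 0 < σ2) (x : ∀ n, ι n → ℝ)
    {a : ℕ → ℝ} (ha : Tendsto a atTop atTop)
    (hcard : Tendsto (fun n => (Fintype.card (ι n) : ℝ) / a n ^ 2) atTop (𝓝 0)) {K : ℝ}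
    (hK : Tendsto (fun n => divergence (signalCov A (Pi0 / σ2) (x n)) / a n) atTop (𝓝 K))
    {α : ℝ} (hα : α ∈ Set.Ioo (0 : ℝ) 1) :
    Tendsto (fun n => -(1 / a n) * Real.log (missProb A Pi0 σ2 (x n) α)) atTop (𝓝 K) := by
  choose v hv hdiv hmiss using fun n => exists_missProb_eq_npMissProb_pi hA Pi0 hσ (x n)
  simp_rw [hmiss]
  refine tendsto_neg_log_npMissProb (X := fun n => ι n → ℝ)
    (L := fun n (z : ι n → ℝ) => ∑ i, gaussianLLR (v n i) (z i))
    (fun n => Finset.measurable_sum _ fun i _ =>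
      (measurable_gaussianLLR (v n i)).comp (measurable_pi_apply i))
    (fun n => pi_gaussianReal_eq_withDensity fun i => (zero_lt_one.trans_le (hv n i)).ne')
    ha ?_ hα
  intro ε hε
  -- Half of `ε` is for the fluctuation about the divergence, bounded by Chebyshev; the other half
  -- is for the distance from the divergence to `K * a n`.
  have hbound := (hcard.const_mul (Var[fun z : ℝ => z ^ 2; gaussianReal 0 1])).mul_const
    ((ε / 2) ^ 2)⁻¹
  rw [mul_zero, zero_mul] at hbound
  refine squeeze_zero' (.of_forall fun n => measureReal_nonneg) ?_ hbound
  filter_upwards [ha.eventually_gt_atTop 0, Metric.tendsto_nhds.1 hK (ε / 2) (by positivity)]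
    with n hn hd
  refine (measureReal_mono fun z hz => ?_).trans
    ((measureReal_deviation_sum_gaussianLLR_le (hv n) (c := ε / 2 * a n) (by positivity)).trans
      (le_of_eq ?_))
  · rw [Set.mem_ofPred_eq, ← hdiv n]
    rw [Set.mem_ofPred_eq] at hz
    have hd' : |divergence (signalCov A (Pi0 / σ2) (x n)) - K * a n| ≤ ε / 2 * a n := by
      rw [Real.dist_eq, div_sub' hn.ne', abs_div, abs_of_pos hn, div_lt_iff₀ hn] at hd
      rw [mul_comm K]
      exact hd.le
    have := abs_sub_le (∑ i, gaussianLLR (v n i) (z i))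
      (divergence (signalCov A (Pi0 / σ2) (x n))) (K * a n)
    linarith
  · rw [mul_pow]
    ring

theorem exists_tendsto_divergence_uniformLoc {A : ℝ} (hA : 0 ≤ A) (Δ : ℝ) (r : ℝ≥0) :
    ∃ K, Tendsto (fun n : ℕ => divergence (signalCov A r (uniformLoc Δ n)) / n) atTop (𝓝 K) := by
  have h : ∀ n, signalCov A r (uniformLoc Δ n) = Matrix.of fun i j : Fin n =>
      (r : ℝ) * Real.exp (-A * |((i : ℕ) : ℝ) * Δ - ((j : ℕ) : ℝ) * Δ|) := fun n => rfl
  simp_rw [h]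
  refine exists_tendsto_divergence_div
    (c := fun i j => (r : ℝ) * Real.exp (-A * |(i : ℝ) * Δ - (j : ℝ) * Δ|)) (fun k i j => ?_)
    fun k => h k ▸ posSemidef_signalCov hA r _
  push_cast
  ring_nf

/-- `B` is the incidence matrix of sensors and clusters. Multiplying by it on the left repeats the
rows within each cluster; on the right it sums `M` equal columns, whence the factor `M` in the SNR.
-/
theorem divergence_signalCov_clusterLoc {A : ℝ} (hA : 0 ≤ A) (Δ : ℝ) (r : ℝ≥0) (N M : ℕ) :
    divergence (signalCov A r (clusterLoc Δ N M))
      = divergence (signalCov A (M * r) (uniformLoc Δ N)) := by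
  let B : Matrix (Fin N × Fin M) (Fin N) ℝ := Matrix.of fun k i => if k.1 = i then 1 else 0
  let C : Matrix (Fin N) (Fin N × Fin M) ℝ := Matrix.of fun i k =>
    signalCov A r (uniformLoc Δ N) i k.1
  have hBC : B * C = signalCov A r (clusterLoc Δ N M) := by
    ext k l
    simp [B, C, Matrix.mul_apply, signalCov, clusterLoc, uniformLoc]
  have hCB : C * B = signalCov A (M * r) (uniformLoc Δ N) := by
    ext i j
    simp [B, C, Matrix.mul_apply, signalCov, uniformLoc, Fintype.sum_prod_type]
    ring
  rw [← hBC, ← hCB]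
  refine divergence_mul_comm B C ?_
  rw [hBC]
  exact (posDef_one_add (posSemidef_signalCov hA r _)).det_pos.ne'

end Exponent

end SensorField

theorem mainTheorem1 (A : ℝ) (hA : 0 ≤ A) :
    ∃ K : ℝ → ℝ → ℝ,
      -- `K Δ snr` is the exponent of uniform configuration, whatever the level
      (∀ (Δ : ℝ) (Pi0 σ2 : ℝ≥0) (α : ℝ), 0 < Δ → 0 < σ2 → α ∈ Set.Ioo (0 : ℝ) 1 →
        SensorField.IsUniformExponent A Pi0 σ2 Δ α (K Δ ((Pi0 : ℝ) / (σ2 : ℝ)))) ∧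
      -- the exponent of periodic clustering
      (∀ (M : ℕ) (Δ : ℝ) (Pi0 σ2 : ℝ≥0) (α : ℝ), 1 ≤ M → 0 < Δ → 0 < σ2 →
        α ∈ Set.Ioo (0 : ℝ) 1 →
        SensorField.IsClusterExponent A Pi0 σ2 M ((M : ℝ) * Δ) α
          (1 / (M : ℝ) * K ((M : ℝ) * Δ) ((M : ℝ) * ((Pi0 : ℝ) / (σ2 : ℝ))))) := by
  choose K hK using fun (Δ : ℝ) (r : ℝ≥0) =>
    SensorField.exists_tendsto_divergence_uniformLoc hA Δ r
  -- Truncating the SNR at 0 is harmless, as only nonnegative values occur.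
  refine ⟨fun Δ s => K Δ s.toNNReal, fun Δ Pi0 σ2 α _ hσ hα => ?_,
    fun M Δ Pi0 σ2 α hM _ hσ hα => ?_⟩
  · beta_reduce
    rw [← NNReal.coe_div, Real.toNNReal_coe]
    refine SensorField.tendsto_neg_log_missProb hA Pi0 hσ (fun n => SensorField.uniformLoc Δ n)
      tendsto_natCast_atTop_atTop ?_ (hK Δ _) hα
    simp only [Fintype.card_fin]
    refine (tendsto_inv_atTop_zero.comp tendsto_natCast_atTop_atTop).congr fun n => ?_
    rw [Function.comp_apply, sq, div_self_mul_self']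
  · have hM' : (0 : ℝ) < M := by exact_mod_cast hM
    have hcast : (M : ℝ) * ((Pi0 : ℝ) / σ2) = ((M * (Pi0 / σ2) : ℝ≥0) : ℝ) := by push_cast; rfl
    beta_reduce
    rw [hcast, Real.toNNReal_coe]
    have ha : Filter.Tendsto (fun N : ℕ => (M : ℝ) * N) Filter.atTop Filter.atTop :=
      tendsto_natCast_atTop_atTop.const_mul_atTop hM'
    refine SensorField.tendsto_neg_log_missProb hA Pi0 hσ
      (fun N => SensorField.clusterLoc ((M : ℝ) * Δ) N M) ha ?_ ?_ hα
    · simp only [Fintype.card_prod, Fintype.card_fin]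
      refine (tendsto_inv_atTop_zero.comp ha).congr fun N => ?_
      push_cast
      rw [Function.comp_apply, sq, mul_comm (N : ℝ), div_self_mul_self']
    -- The divergence is now that of `N` uniformly spaced sensors, but divided by `M * N`; this is
    -- the factor `1 / M`.
    · simp_rw [SensorField.divergence_signalCov_clusterLoc hA]
      refine ((hK (M * Δ) (M * (Pi0 / σ2))).const_mul (1 / (M : ℝ))).congr fun N => ?_
      ring
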